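/- **Theorem 3.3 (finite $T^1$ $\Leftrightarrow$ isolated singularity).** Let $f_1,\dots,f_r\in\mathbb{C}[x_1,\dots,x_n]$ be polynomials such that $X=V(f_1,\dots,f_r)\subset\mathbb{C}^n$ is a complete intersection, i.e. at every point $q\in X$ the germs of $f_1,\dots,f_r$ form a regular sequence in the local ring $\mathcal{O}_{\mathbb{C}^n,q}$ of $\mathbb C^n$ at $q$ (the localization of $\mathbb{C}[x_1,\dots,x_n]$ at the maximal ideal of $q$). For $q\in X$ let $\mathcal{O}_{X,q}=\mathcal{O}_{\mathbb{C}^n,q}/(f_1,\dots,f_r)$; the point $q$ is called singular if $\mathcal{O}_{X,q}$ is not a regular local ring. A singular point $p$ is called isolated if some Zariski-open neighbourhood of $p$ contains no singular point of $X$ other than $p$. Let $p\in X$. 1. Suppose that $\mathcal{O}_{X,p}$ is reduced, and let $$T^1_{X,p}=\operatorname{Ext}^1_{\mathcal{O}_{X,p}}\bigl(\Omega^1_{X,p},\mathcal{O}_{X,p}\bigr),$$ where $\Omega^1_{X,p}$ is the module of Kähler differentials of $\mathcal{O}_{X,p}$ over $\mathbb{C}$. Then $\dim_{\mathbb{C}}T^1_{X,p}<\infty$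 if and only if $p$ is a nonsingular point or an isolated singular point of $X$. 2. Whether or not $\mathcal{O}_{X,p}$ is reduced, the cokernel of the Jacobian map $J_f=(\partial f_i/\partial x_j)_{i,j}:\mathcal{O}_{X,p}^{\,n}\to\mathcal{O}_{X,p}^{\,r}$ has finite dimension over $\mathbb{C}$ if and only if $p$ is a nonsingular point or an isolated singular point of $X$. In particular, at a singular point $p$ either space is finite-dimensional (the first one for reduced $\mathcal{O}_{X,p}$) if and only if $p$ is an isolated singular point of $X$. -/

import Mathlib

/-!
Complete intersections `X = V(f₁, …, f_r) ⊂ ℂⁿ` defined by polynomials, their local rings, the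
space `T¹` of first-order deformations at a point, and isolated singular points.
-/

noncomputable section

namespace CIDeformation

open CategoryTheory

variable {n r : ℕ}

/-- The maximal ideal of `ℂ[x₁, …, xₙ]` of polynomials vanishing at `p`. -/
abbrev pointIdeal (p : Fin n → ℂ) : Ideal (MvPolynomial (Fin n) ℂ) :=
  RingHom.ker (MvPolynomial.eval p)

instance (p : Fin n → ℂ) : (pointIdeal p).IsPrime :=
  RingHom.ker_isPrime _

/-- The local ring `𝒪_{ℂⁿ,p}` of affine space at `p`. -/
abbrev AffineLocalRing (p : Fin n → ℂ) : Type :=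
  Localization.AtPrime (pointIdeal p)

/-- The germ at `p` of a polynomial. -/
abbrev germ (p : Fin n → ℂ) (g : MvPolynomial (Fin n) ℂ) : AffineLocalRing p :=
  algebraMap (MvPolynomial (Fin n) ℂ) (AffineLocalRing p) g

/-- The set of points of `X = V(f₁, …, f_r) ⊂ ℂⁿ`. -/
def points (f : Fin r → MvPolynomial (Fin n) ℂ) : Set (Fin n → ℂ) :=
  {q | ∀ i, MvPolynomial.eval q (f i) = 0}

/-- The ideal `(f₁, …, f_r)` of `𝒪_{ℂⁿ,p}`. -/
abbrev idealAt (f : Fin r → MvPolynomial (Fin n) ℂ) (p : Fin n → ℂ) :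
    Ideal (AffineLocalRing p) :=
  Ideal.span (Set.range fun i => germ p (f i))

/-- The local ring `𝒪_{X,p} = 𝒪_{ℂⁿ,p} / (f₁, …, f_r)`. -/
abbrev LocalRingAt (f : Fin r → MvPolynomial (Fin n) ℂ) (p : Fin n → ℂ) : Type :=
  AffineLocalRing p ⧸ idealAt f p

/-- `X = V(f₁, …, f_r)` is a complete intersection: at each point `q` of `X` the germs of
`f₁, …, f_r` form a regular sequence in `𝒪_{ℂⁿ,q}`.  (This holds in particular if `f₁, …, f_r` is
a regular sequence in `ℂ[x₁, …, xₙ]`; since `𝒪_{ℂⁿ,q}` is Cohen-Macaulay, it says that all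
irreducible components of `X` have codimension `r`.) -/
def IsCompleteIntersection (f : Fin r → MvPolynomial (Fin n) ℂ) : Prop :=
  ∀ q ∈ points f,
    RingTheory.Sequence.IsRegular (AffineLocalRing q) (List.ofFn fun i => germ q (f i))

/-- The singular locus of `X`: the points of `X` whose local ring is not regular. -/
def singularLocus (f : Fin r → MvPolynomial (Fin n) ℂ) : Set (Fin n → ℂ) :=
  {q | q ∈ points f ∧ ¬ IsRegularLocalRing (LocalRingAt f q)}

/-- `p` is an isolated singular point of `X`: it is a singular point, and in some Zariski
neighbourhood of `p` (which may be taken to be a principal open set `g ≠ 0`) there is no other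
singular point of `X`. -/
def IsIsolatedSingularPoint (f : Fin r → MvPolynomial (Fin n) ℂ) (p : Fin n → ℂ) : Prop :=
  p ∈ singularLocus f ∧
    ∃ g : MvPolynomial (Fin n) ℂ, MvPolynomial.eval p g ≠ 0 ∧
      ∀ q ∈ singularLocus f, MvPolynomial.eval q g ≠ 0 → q = p

/-- `Ext¹_A(Ω¹_{A/ℂ}, A)` for a commutative `ℂ`-algebra `A`, where `Ω¹_{A/ℂ}` is the module of
Kähler differentials. -/
abbrev ExtOneKaehler (A : Type) [CommRing A] [Algebra ℂ A] : Type :=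
  Abelian.Ext.{0} (ModuleCat.of A Ω[A⁄ℂ]) (ModuleCat.of A A) 1

/-- The space of first-order deformations `T¹_{X,p} = Ext¹(Ω¹_{X,p}, 𝒪_{X,p})` over `𝒪_{X,p}`. -/
abbrev T1 (f : Fin r → MvPolynomial (Fin n) ℂ) (p : Fin n → ℂ) : Type :=
  ExtOneKaehler (LocalRingAt f p)

/-- The Jacobian matrix `(∂f_i/∂x_j)` with entries in `𝒪_{X,p}`. -/
def jacobianAt (f : Fin r → MvPolynomial (Fin n) ℂ) (p : Fin n → ℂ) :
    Matrix (Fin r) (Fin n) (LocalRingAt f p) :=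
  Matrix.of fun i j => Ideal.Quotient.mk (idealAt f p) (germ p (MvPolynomial.pderiv j (f i)))

/-- The cokernel of the Jacobian map `J_f : 𝒪_{X,p}ⁿ → 𝒪_{X,p}^r`. -/
abbrev JacobianCokernel (f : Fin r → MvPolynomial (Fin n) ℂ) (p : Fin n → ℂ) : Type :=
  (Fin r → LocalRingAt f p) ⧸ LinearMap.range (jacobianAt f p).mulVecLin

end CIDeformation

end

noncomputable section

/-! Write `A` for the local ring of `X` at `p`, `I` for the ideal of the germs and `C` for the
cokernel of the Jacobian matrix `J` over `A`.

Finiteness of `C`: at a point `q` of `X` the cotangent space has dimension `n - rank J(q)`, while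
the local ring has dimension `n - r` because the germs form a regular sequence. So `q` is
nonsingular exactly when `J` is surjective there, and the singular locus is the zero set of the
annihilator `jacobianIdeal` of the cokernel over `ℂ[x]/(f)`. On the other side, `C` is
finite-dimensional iff every element of the maximal ideal acts nilpotently on it. The
Nullstellensatz matches the two conditions (`not_mem_or_isIsolated_iff`).

Comparison with `T¹`: the conormal sequence presents the differentials of `A` as the cokernel of `Jᵗ
: A^r → A^n`. If `A` is reduced, `Jᵗ` is injective (`jacobian_transpose_injective`), and dualizing
the resulting free resolution gives `Ext¹ = C`. For injectivity, let `Jᵗ c = 0` and `F = ∑ cᵢ fᵢ`.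
Both `F` and its partial derivatives lie in `I`, so at a minimal prime `Q` of `I` the function `F`
lies in the square of the maximal ideal, which is `I_Q²` by reducedness. Regularity of the sequence
then forces `cᵢ ∈ Q`, and the minimal primes of `I` intersect in `I`. -/

theorem Ideal.ofList_ofFn_eq_span {R : Type*} [CommRing R] {r : ℕ} (f : Fin r → R) :
    Ideal.ofList (List.ofFn f) = Ideal.span (Set.range f) := by
  simp only [Ideal.ofList]
  congr 1
  ext x
  simp [List.mem_ofFn]

/-! ### Relations among the members of a regular sequence. -/

namespace RingTheory.Sequence

/-- The last member is regular modulo the earlier ones, so its coefficient is a combination `∑ dⱼ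
fⱼ` of them; substituting this leaves a shorter relation, with coefficients `cⱼ + dⱼ f_last`. -/
theorem IsWeaklyRegular.mem_span_of_sum_mul_eq_zero {R : Type*} [CommRing R] {r : ℕ}
    {f c : Fin r → R} (hf : IsWeaklyRegular R (List.ofFn f)) (h : ∑ i, c i * f i = 0) (i : Fin r) :
    c i ∈ Ideal.span (Set.range f) := by
  induction r with
  | zero => exact i.elim0
  | succ r ih =>
    have hsp := Ideal.ofList_ofFn_eq_span fun j : Fin r => f j.castSucc
    have hle : Ideal.span (Set.range fun j : Fin r => f j.castSucc) ≤ Ideal.span (Set.range f) :=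
      Ideal.span_mono (by rintro _ ⟨j, rfl⟩; exact ⟨_, rfl⟩)
    rw [List.ofFn_succ', List.concat_eq_append, isWeaklyRegular_append_iff,
      isWeaklyRegular_singleton_iff, smul_eq_mul, Ideal.mul_top, hsp,
      isSMulRegular_quotient_iff_mem_of_smul_mem] at hf
    rw [Fin.sum_univ_castSucc] at h
    have hlast : c (Fin.last r) ∈ Ideal.span (Set.range fun j : Fin r => f j.castSucc) := by
      apply hf.2
      rw [smul_eq_mul, mul_comm, eq_neg_of_add_eq_zero_right h]
      exact neg_mem (sum_mem fun j _ => Ideal.mul_mem_left _ _ (Ideal.subset_span ⟨j, rfl⟩))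
    obtain ⟨d, hd⟩ := Ideal.mem_span_range_iff_exists_fun.mp hlast
    have key := ih (c := fun j => c j.castSucc + d j * f (Fin.last r)) hf.1 (by
      rw [← h, ← hd, Finset.sum_mul, ← Finset.sum_add_distrib]
      exact Finset.sum_congr rfl fun j _ => by ring)
    refine Fin.lastCases (hle hlast) (fun j => ?_) i
    have := sub_mem (hle (key j))
      (Ideal.mul_mem_left (Ideal.span (Set.range f)) (d j) (Ideal.subset_span ⟨Fin.last r, rfl⟩))
    simpa using this

/-- Independence of the classes of the `fᵢ` in `I/I²` over `R/I`: an element of `I²` is `∑ bᵢ fᵢ`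
with `bᵢ ∈ I`, and `c - b` is then a relation. -/
theorem IsWeaklyRegular.mem_span_of_sum_mul_mem_sq {R : Type*} [CommRing R] {r : ℕ}
    {f c : Fin r → R} (hf : IsWeaklyRegular R (List.ofFn f))
    (h : ∑ i, c i * f i ∈ Ideal.span (Set.range f) ^ 2) (i : Fin r) :
    c i ∈ Ideal.span (Set.range f) := by
  have : ∃ b : Fin r → R, (∀ i, b i ∈ Ideal.span (Set.range f)) ∧
      ∑ i, b i * f i = ∑ i, c i * f i := by
    rw [sq, ← smul_eq_mul] at h
    obtain ⟨b, hb⟩ := (Submodule.mem_ideal_smul_span_iff_exists_sum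
      (Ideal.span (Set.range f)) f _).mp h
    obtain ⟨hb, e⟩ := hb
    refine ⟨b, hb, ?_⟩
    rw [← e, Finsupp.sum_fintype _ _ (by simp)]
    simp
  obtain ⟨b, hb, e⟩ := this
  have key := hf.mem_span_of_sum_mul_eq_zero (c := fun i => c i - b i)
    (by simp [sub_mul, e]) i
  simpa using add_mem key (hb i)

theorem IsRegular.span_ne_top {R : Type*} [CommRing R] {r : ℕ} {f : Fin r → R}
    (hf : IsRegular R (List.ofFn f)) : Ideal.span (Set.range f) ≠ ⊤ := fun h => hf.top_ne_smul (by
  rw [Ideal.ofList_ofFn_eq_span, h, smul_eq_mul, Ideal.mul_top])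

end RingTheory.Sequence

/-! ### The conormal sequence and its exactness on the left. -/

section

open TensorProduct KaehlerDifferential

namespace Conormal

section Presentation

variable {k R : Type*} [CommRing k] [CommRing R] [Algebra k R] {n r : ℕ}
  (b : Module.Basis (Fin n) R Ω[R⁄k]) (f : Fin r → R)

/-- The Jacobian matrix of `f` over `R ⧸ (f)` with respect to a basis of the differentials. -/
def jacobian : Matrix (Fin r) (Fin n) (R ⧸ Ideal.span (Set.range f)) :=
  Matrix.of fun i j => Ideal.Quotient.mk _ (b.repr (D k R (f i)) j)

/-- The surjection onto the differentials of `R ⧸ (f)` given by a basis of the differentials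
of `R`. -/
def toKaehler : (Fin n → R ⧸ Ideal.span (Set.range f)) →ₗ[R ⧸ Ideal.span (Set.range f)]
    Ω[R ⧸ Ideal.span (Set.range f)⁄k] :=
  mapBaseChange k R (R ⧸ Ideal.span (Set.range f)) ∘ₗ
    (b.baseChange (R ⧸ Ideal.span (Set.range f))).equivFun.symm.toLinearMap

theorem toKaehler_surjective : Function.Surjective (toKaehler b f) :=
  (mapBaseChange_surjective k R _ Ideal.Quotient.mk_surjective).comp
    (LinearEquiv.surjective _)

/-- By the Leibniz rule `d(∑ cᵢ fᵢ)` is `∑ cᵢ dfᵢ` up to the terms `fᵢ dcᵢ`, which vanish modulo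
`(f)`. -/
theorem jacobian_transpose_mulVec (c : Fin r → R) (j : Fin n) :
    ((jacobian b f).transpose.mulVec fun i => Ideal.Quotient.mk _ (c i)) j =
      Ideal.Quotient.mk _ (b.repr (D k R (∑ i, c i * f i)) j) := by
  simp only [Matrix.mulVec, dotProduct, Matrix.transpose_apply, jacobian, Matrix.of_apply,
    map_sum, Derivation.leibniz, map_add, map_smul, Finsupp.coe_add, Finsupp.coe_smul,
    Pi.add_apply, Pi.smul_apply, smul_eq_mul, map_mul, Finsupp.coe_finsetSum, Finset.sum_apply]
  refine Finset.sum_congr rfl fun i _ => ?_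
  have : Ideal.Quotient.mk (Ideal.span (Set.range f)) (f i) = 0 :=
    Ideal.Quotient.eq_zero_iff_mem.mpr (Ideal.subset_span ⟨i, rfl⟩)
  rw [this]
  ring

theorem exact_jacobian_toKaehler :
    Function.Exact (jacobian b f).transpose.mulVecLin (toKaehler b f) := by
  have hrepr : ∀ F : R, (b.baseChange (R ⧸ Ideal.span (Set.range f))).equivFun
      (1 ⊗ₜ D k R F) = fun j => Ideal.Quotient.mk _ (b.repr (D k R F) j) := by
    intro F
    ext j
    simp [Module.Basis.baseChange_repr_tmul, Algebra.smul_def]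
  intro v
  have hex := exact_kerCotangentToTensor_mapBaseChange k R (R ⧸ Ideal.span (Set.range f))
    Ideal.Quotient.mk_surjective
    ((b.baseChange (R ⧸ Ideal.span (Set.range f))).equivFun.symm v)
  have h0 : toKaehler b f v = 0 ↔ _ := hex
  rw [h0]
  constructor
  · rintro ⟨y, hy⟩
    obtain ⟨⟨F, hF⟩, rfl⟩ := Ideal.toCotangent_surjective _ y
    rw [kerCotangentToTensor_toCotangent, LinearEquiv.eq_symm_apply, hrepr] at hy
    have hF' : F ∈ Ideal.span (Set.range f) := by
      rwa [RingHom.mem_ker, Ideal.Quotient.algebraMap_eq, Ideal.Quotient.eq_zero_iff_mem] at hF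
    obtain ⟨c, hc⟩ := Ideal.mem_span_range_iff_exists_fun.mp hF'
    refine ⟨fun i => Ideal.Quotient.mk _ (c i), ?_⟩
    rw [← hy]
    ext j
    rw [Matrix.mulVecLin_apply, jacobian_transpose_mulVec, hc]
  · rintro ⟨c, rfl⟩
    choose c' hc' using fun i => Ideal.Quotient.mk_surjective (c i)
    obtain rfl : (fun i => Ideal.Quotient.mk _ (c' i)) = c := funext hc'
    have hF : ∑ i, c' i * f i ∈ RingHom.ker (algebraMap R (R ⧸ Ideal.span (Set.range f))) := by
      rw [RingHom.mem_ker, Ideal.Quotient.algebraMap_eq, Ideal.Quotient.eq_zero_iff_mem]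
      exact Ideal.mem_span_range_iff_exists_fun.mpr ⟨c', rfl⟩
    refine ⟨Ideal.toCotangent _ ⟨_, hF⟩, ?_⟩
    rw [kerCotangentToTensor_toCotangent, LinearEquiv.eq_symm_apply, hrepr]
    ext j
    rw [Matrix.mulVecLin_apply, jacobian_transpose_mulVec]

end Presentation

/-- The localization of `R/I` at a minimal prime is reduced with a single prime, hence a field. -/
theorem map_atPrime_eq_maximalIdeal {R : Type*} [CommRing R] {I Q : Ideal R} (hI : I.IsRadical)
    [Q.IsPrime] (hQ : Q ∈ I.minimalPrimes) :
    I.map (algebraMap R (Localization.AtPrime Q)) =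
      IsLocalRing.maximalIdeal (Localization.AtPrime Q) := by
  rw [← Localization.AtPrime.map_eq_maximalIdeal]
  refine le_antisymm (Ideal.map_mono hQ.1.2) (Ideal.map_le_iff_le_comap.mpr fun x hx => ?_)
  -- Otherwise some prime containing `I` avoids both the complement of `Q` and `x`; it lies in `Q`
  -- but misses `x ∈ Q`, against minimality.
  obtain ⟨s, hs, N, hN⟩ : ∃ s ∉ Q, ∃ N : ℕ, s * x ^ N ∈ I := by
    by_contra! hcon
    have hdisj : Disjoint (I : Set R) (Q.primeCompl ⊔ Submonoid.powers x : Submonoid R) := by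
      rw [Set.disjoint_right]
      intro y hy
      obtain ⟨s, hs, _, ⟨N, rfl⟩, rfl⟩ := Submonoid.mem_sup.mp hy
      exact hcon s hs N
    obtain ⟨P, hP, hIP, hPd⟩ := Ideal.exists_le_prime_disjoint _ _ hdisj
    rw [Set.disjoint_right] at hPd
    have hPQ : P ≤ Q := fun y hy => by
      by_contra hyQ
      exact hPd (SetLike.le_def.mp le_sup_left (show y ∈ Q.primeCompl from hyQ)) hy
    exact hPd (SetLike.le_def.mp le_sup_right (Submonoid.mem_powers x)) (hQ.2 ⟨hP, hIP⟩ hPQ hx)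
  -- The exponent `N + 1` guarantees a factor `s` even when `N = 0`.
  have : s * x ∈ I := hI ⟨N + 1, by
    rw [mul_pow, pow_succ s, pow_succ x]
    convert I.mul_mem_left (s ^ N * x) hN using 1
    ring⟩
  rw [Ideal.mem_comap, IsLocalization.mem_map_algebraMap_iff Q.primeCompl]
  exact ⟨⟨⟨_, this⟩, ⟨s, hs⟩⟩, by simp [mul_comm]⟩

variable {k R : Type*} [Field k] [PerfectField k] [CommRing R] [Algebra k R]
  [Algebra.FormallySmooth k R] [Algebra.EssFiniteType k R] {n r : ℕ}
  (b : Module.Basis (Fin n) R Ω[R⁄k])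

/-- A function in a prime `Q` all of whose partial derivatives lie in `Q` lies in the square of
the maximal ideal of the localization at `Q`. -/
theorem algebraMap_mem_maximalIdeal_sq {Q : Ideal R} [Q.IsPrime] {F : R} (hF : F ∈ Q)
    (hD : ∀ j, b.repr (D k R F) j ∈ Q) :
    algebraMap R (Localization.AtPrime Q) F ∈
      IsLocalRing.maximalIdeal (Localization.AtPrime Q) ^ 2 := by
  let RQ := Localization.AtPrime Q
  let κ := IsLocalRing.ResidueField RQ
  have hs : Function.Surjective (algebraMap RQ κ) := IsLocalRing.residue_surjective
  have hess : Algebra.EssFiniteType k RQ := Algebra.EssFiniteType.comp k R RQ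
  have hess' : Algebra.EssFiniteType k κ := Algebra.EssFiniteType.comp k RQ κ
  have hsm : Algebra.FormallySmooth k κ := Algebra.FormallySmooth.of_perfectField
  -- Since `k` is perfect, the residue field is formally smooth over it, so `m/m² → κ ⊗ Ω` is split
  -- injective and it suffices that `dF` vanishes in `κ ⊗ Ω`.
  obtain ⟨l, hl⟩ := (Algebra.FormallySmooth.iff_split_injection (R := k) hs).mp hsm
  have hker : RingHom.ker (algebraMap RQ κ) = IsLocalRing.maximalIdeal RQ :=
    IsLocalRing.ker_residue
  have hFQ : algebraMap R RQ F ∈ RingHom.ker (algebraMap RQ κ) := by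
    rw [hker]
    exact (IsLocalization.AtPrime.to_map_mem_maximal_iff RQ Q F).mpr hF
  have h0 : kerCotangentToTensor k RQ κ (Ideal.toCotangent _ ⟨_, hFQ⟩) = 0 := by
    rw [kerCotangentToTensor_toCotangent]
    have : D k RQ (algebraMap R RQ F) = ∑ j, algebraMap R RQ (b.repr (D k R F) j) •
        KaehlerDifferential.map k k R RQ (b j) := by
      rw [← KaehlerDifferential.map_D k k R RQ]
      conv_lhs => rw [← b.sum_repr (D k R F)]
      simp only [map_sum, map_smul, algebraMap_smul]
    rw [this, TensorProduct.tmul_sum]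
    refine Finset.sum_eq_zero fun j _ => ?_
    rw [← TensorProduct.smul_tmul, Algebra.smul_def, mul_one]
    have : algebraMap R RQ (b.repr (D k R F) j) ∈ RingHom.ker (algebraMap RQ κ) := by
      rw [hker]
      exact (IsLocalization.AtPrime.to_map_mem_maximal_iff RQ Q _).mpr (hD j)
    rw [RingHom.mem_ker.mp this, TensorProduct.zero_tmul]
  have h1 : (RingHom.ker (algebraMap RQ κ)).toCotangent ⟨_, hFQ⟩ = 0 := by
    have := LinearMap.congr_fun hl ((RingHom.ker (algebraMap RQ κ)).toCotangent ⟨_, hFQ⟩)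
    rw [LinearMap.comp_apply, h0, map_zero] at this
    exact this.symm
  rw [Ideal.toCotangent_eq_zero] at h1
  exact hker ▸ h1

theorem jacobian_transpose_injective {f : Fin r → R}
    (hf : RingTheory.Sequence.IsWeaklyRegular R (List.ofFn f))
    (hred : IsReduced (R ⧸ Ideal.span (Set.range f))) :
    Function.Injective (jacobian b f).transpose.mulVecLin := by
  have hI : (Ideal.span (Set.range f)).IsRadical :=
    (Ideal.isRadical_iff_quotient_reduced _).mpr hred
  rw [injective_iff_map_eq_zero]
  intro c hc
  choose c' hc' using fun i => Ideal.Quotient.mk_surjective (c i)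
  obtain rfl : (fun i => Ideal.Quotient.mk _ (c' i)) = c := funext hc'
  have hF : ∑ i, c' i * f i ∈ Ideal.span (Set.range f) :=
    Ideal.mem_span_range_iff_exists_fun.mpr ⟨c', rfl⟩
  have hD : ∀ j, b.repr (D k R (∑ i, c' i * f i)) j ∈ Ideal.span (Set.range f) := fun j => by
    rw [← Ideal.Quotient.eq_zero_iff_mem, ← jacobian_transpose_mulVec]
    exact congr_fun hc j
  ext i
  rw [Pi.zero_apply, Ideal.Quotient.eq_zero_iff_mem, ← hI.radical, ← Ideal.sInf_minimalPrimes,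
    Ideal.mem_sInf]
  intro Q hQ
  have : Q.IsPrime := hQ.1.1
  have h := algebraMap_mem_maximalIdeal_sq b (hQ.1.2 hF) fun j => hQ.1.2 (hD j)
  rw [← map_atPrime_eq_maximalIdeal hI hQ, ← Ideal.map_pow,
    IsLocalization.mem_map_algebraMap_iff Q.primeCompl] at h
  obtain ⟨⟨⟨G, hG⟩, s⟩, e⟩ := h
  rw [← map_mul] at e
  obtain ⟨t, ht⟩ := (IsLocalization.eq_iff_exists Q.primeCompl _).mp e
  -- Clearing denominators: `F ∈ I_Q²` means that `t s F ∈ I²` for some `t, s ∉ Q`.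
  have key : ∑ i, (t * s * c' i) * f i ∈ Ideal.span (Set.range f) ^ 2 := by
    convert Ideal.mul_mem_left _ (t : R) hG using 1
    rw [← ht, Finset.sum_mul, Finset.mul_sum]
    exact Finset.sum_congr rfl fun i _ => by ring
  have := hQ.1.2 (hf.mem_span_of_sum_mul_mem_sq key i)
  exact (Ideal.IsPrime.mem_or_mem ‹_› this).resolve_left (t * s).2

end Conormal

end

/-! ### `Ext¹` from a free resolution of length one. -/

section

open CategoryTheory Abelian

namespace Conormal

universe u

variable {k A : Type u} [Field k] [CommRing A] [Algebra k A]

/-- For a presentation `0 → A^r → A^n → M → 0`, the group `Ext¹(M, A)` is the cokernel of the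
transposed matrix. -/
theorem finite_extOne_iff {M : Type u} [AddCommGroup M] [Module A M] {n r : ℕ}
    (J : Matrix (Fin r) (Fin n) A) (π : (Fin n → A) →ₗ[A] M) (hπ : Function.Surjective π)
    (hex : Function.Exact J.transpose.mulVecLin π)
    (hinj : Function.Injective J.transpose.mulVecLin) :
    Module.Finite k (Ext.{u} (ModuleCat.of A M) (ModuleCat.of A A) 1) ↔
      Module.Finite k ((Fin r → A) ⧸ LinearMap.range J.mulVecLin) := by
  let S : ShortComplex (ModuleCat.{u} A) :=
    ShortComplex.mk (ModuleCat.ofHom J.transpose.mulVecLin) (ModuleCat.ofHom π)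
      (by ext1; exact hex.linearMap_comp_eq_zero)
  have hS : S.ShortExact :=
    { exact := (ShortComplex.moduleCat_exact_iff _).mpr fun x hx => (hex x).mp hx
      mono_f := (ModuleCat.mono_iff_injective _).mpr hinj
      epi_g := (ModuleCat.epi_iff_surjective _).mpr hπ }
  have : Projective S.X₂ := ModuleCat.projective_of_free (Pi.basisFun A (Fin n))
  let Y := ModuleCat.of A A
  let w : (Fin r → A) → (S.X₁ ⟶ Y) := fun v =>
    ModuleCat.ofHom ((Pi.basisFun A (Fin r)).constr k v)
  have hw : ∀ u v : Fin r → A, (w v).hom u = v ⬝ᵥ u := fun u v => by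
    simp only [w, ModuleCat.hom_ofHom, Module.Basis.constr_apply_fintype, smul_eq_mul]
    exact dotProduct_comm u v
  have w_surj : Function.Surjective w := fun g =>
    ⟨((Pi.basisFun A (Fin r)).constr k).symm g.hom, by simp [w]⟩
  let Θ : (Fin r → A) →ₗ[k] Ext.{u} S.X₃ Y 1 :=
    { toFun v := hS.extClass.comp (Ext.mk₀ (w v)) rfl
      map_add' u v := by
        have : w (u + v) = w u + w v := by simp only [w, map_add]; rfl
        rw [this, Ext.mk₀_add, Ext.comp_add]
      map_smul' c v := by
        rw [RingHom.id_apply, Ext.smul_eq_comp_mk₀, Ext.comp_assoc_of_third_deg_zero,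
          Ext.mk₀_comp_mk₀]
        congr 2
        refine ModuleCat.hom_ext (LinearMap.ext fun x => ?_)
        rw [hw, smul_dotProduct, ← hw]
        exact Algebra.smul_def c _ }
  have hΘ : ∀ v, Θ v = hS.extClass.comp (Ext.mk₀ (w v)) rfl := fun v => rfl
  -- The connecting map is onto because `Ext¹(Aⁿ, A) = 0`.
  have hsurj : Function.Surjective Θ := fun x => by
    obtain ⟨y, hy⟩ := Ext.contravariant_sequence_exact₃ hS Y x
      (Ext.eq_zero_of_projective _) (n₀ := 0) rfl
    obtain ⟨g, rfl⟩ := Ext.addEquiv₀.symm.surjective y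
    obtain ⟨v, rfl⟩ := w_surj g
    exact ⟨v, hy⟩
  -- A functional on `A^r` dies in `Ext¹` iff it extends along `Jᵗ` to a functional `u` on `Aⁿ`,
  -- that is, iff its vector is `J u`.
  have hker : LinearMap.ker Θ = (LinearMap.range J.mulVecLin).restrictScalars k := by
    ext v
    rw [LinearMap.mem_ker, hΘ, Submodule.restrictScalars_mem, LinearMap.mem_range]
    constructor
    · intro h
      obtain ⟨y, hy⟩ := Ext.contravariant_sequence_exact₁ hS Y _ rfl h
      obtain ⟨g, rfl⟩ := Ext.addEquiv₀.symm.surjective y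
      replace hy : (Ext.mk₀ S.f).comp (Ext.mk₀ g) (zero_add 0) = Ext.mk₀ (w v) := hy
      rw [Ext.mk₀_comp_mk₀] at hy
      replace hy : S.f ≫ g = w v := Ext.addEquiv₀.symm.injective hy
      refine ⟨fun j => g.hom (Pi.single j 1), ?_⟩
      have hg : ∀ u : Fin n → A, g.hom u = (fun j => g.hom (Pi.single j 1)) ⬝ᵥ u := fun u => by
        conv_lhs => rw [pi_eq_sum_univ' u, map_sum]
        refine Finset.sum_congr rfl fun j _ => ?_
        rw [map_smul, smul_eq_mul, mul_comm]
      ext i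
      have := congr_arg (fun h => h.hom (Pi.single i 1)) hy
      simp only [hw, dotProduct_single_one] at this
      rw [← this]
      change _ = g.hom (J.transpose.mulVec (Pi.single i 1))
      rw [hg, Matrix.mulVec_single_one, dotProduct_comm]
      rfl
    · rintro ⟨u, rfl⟩
      have : w (J.mulVecLin u) = S.f ≫ ModuleCat.ofHom ((Pi.basisFun A (Fin n)).constr k u) := by
        refine ModuleCat.hom_ext (LinearMap.ext fun x => ?_)
        change (w (J.mulVecLin u)).hom x =
          (Pi.basisFun A (Fin n)).constr k u (J.transpose.mulVec x)
        rw [hw]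
        simp only [Module.Basis.constr_apply_fintype, Pi.basisFun_equivFun, LinearEquiv.refl_apply,
          smul_eq_mul]
        change _ = J.transpose.mulVec x ⬝ᵥ u
        rw [Matrix.mulVec_transpose, ← Matrix.dotProduct_mulVec, dotProduct_comm]
        rfl
      rw [this, ← Ext.mk₀_comp_mk₀, ShortComplex.ShortExact.extClass_comp_assoc]
  refine ⟨fun h => ?_, fun h => ?_⟩
  · have e := (Submodule.quotEquivOfEq _ _ hker.symm) ≪≫ₗ Θ.quotKerEquivOfSurjective hsurj
    exact Module.Finite.equiv (e.symm ≪≫ₗ Submodule.Quotient.restrictScalarsEquiv k _)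
  · have e := (Submodule.quotEquivOfEq _ _ hker.symm) ≪≫ₗ Θ.quotKerEquivOfSurjective hsurj
    exact Module.Finite.equiv ((Submodule.Quotient.restrictScalarsEquiv k _).symm ≪≫ₗ e)

end Conormal

end

/-! ### The Jacobian criterion. -/

section

open TensorProduct KaehlerDifferential IsLocalRing

namespace Conormal

/-- The rank of a matrix modulo the maximal ideal determines the fibre of its cokernel. -/
theorem finrank_tensor_add_rank {A K : Type*} [CommRing A] [Field K] [Algebra A K] {a b : ℕ}
    {P : Type*} [AddCommGroup P] [Module A P] (M : Matrix (Fin b) (Fin a) A)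
    (π : (Fin b → A) →ₗ[A] P) (hπ : Function.Surjective π)
    (hex : Function.Exact M.mulVecLin π) :
    Module.finrank K (K ⊗[A] P) + (M.map (algebraMap A K)).rank = b := by
  let e₁ := piScalarRight A K K (Fin a)
  let e₂ := piScalarRight A K K (Fin b)
  have hcomm : e₂.toLinearMap ∘ₗ M.mulVecLin.baseChange K =
      (M.map (algebraMap A K)).mulVecLin ∘ₗ e₁.toLinearMap := by
    ext i j
    simp [e₁, e₂, Pi.single_apply, Algebra.smul_def, Matrix.mulVec, dotProduct]
  have hsurj : Function.Surjective (π.baseChange K) := LinearMap.lTensor_surjective K hπ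
  have hker : LinearMap.ker (π.baseChange K) = LinearMap.range (M.mulVecLin.baseChange K) := by
    ext x
    exact lTensor_exact K hex hπ x
  have h1 := LinearMap.finrank_range_add_finrank_ker (π.baseChange K)
  rw [LinearMap.range_eq_top.mpr hsurj, finrank_top, hker, e₂.finrank_eq, Module.finrank_fin_fun]
    at h1
  refine Eq.trans ?_ h1
  rw [Matrix.rank, ← e₁.range_comp, ← hcomm, LinearMap.range_comp,
    LinearEquiv.finrank_map_eq e₂]

section LocalRing

variable {k A : Type*} [Field k] [CommRing A] [IsLocalRing A] [Algebra k A]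

/-- With residue field `k`, the inverse of `k ≃ κ` gives a section of `A → κ`, so `m/m² → κ ⊗ Ω` is
injective; it is onto because `Ω[κ⁄k] = 0`. -/
theorem finrank_cotangentSpace_eq_finrank_kaehler
    (hk : Function.Surjective (algebraMap k (ResidueField A))) :
    Module.finrank (ResidueField A) (CotangentSpace A) =
      Module.finrank (ResidueField A) (ResidueField A ⊗[A] Ω[A⁄k]) := by
  let κ := ResidueField A
  have hs : Function.Surjective (algebraMap A κ) := residue_surjective
  let e₀ : k ≃ₐ[k] κ := AlgEquiv.ofBijective (Algebra.ofId k κ) ⟨(algebraMap k κ).injective, hk⟩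
  obtain ⟨l, hl⟩ := (retractionKerCotangentToTensorEquivSection (R := k) hs).symm
    ⟨(Algebra.ofId k _).comp e₀.symm.toAlgHom, by
      ext x
      obtain ⟨c, rfl⟩ := hk x
      exact AlgHom.commutes (_ : κ →ₐ[k] κ) c⟩
  have hinj : Function.Injective (kerCotangentToTensor k A κ) :=
    Function.LeftInverse.injective (g := l) (LinearMap.congr_fun hl)
  have : Subsingleton Ω[κ⁄k] := KaehlerDifferential.subsingleton_of_surjective k κ hk
  have hsurj : Function.Surjective (kerCotangentToTensor k A κ) := fun x =>
    (exact_kerCotangentToTensor_mapBaseChange k A κ hs x).mp (Subsingleton.elim _ _)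
  have hker : maximalIdeal A = RingHom.ker (algebraMap A κ) := ker_residue.symm
  have e : CotangentSpace A ≃ₗ[A] κ ⊗[A] Ω[A⁄k] :=
    Ideal.Cotangent.equivOfEq _ _ hker ≪≫ₗ LinearEquiv.ofBijective _ ⟨hinj, hsurj⟩
  exact (e.extendScalarsOfSurjective hs).finrank_eq

end LocalRing

instance isLocalRing_quotient {R : Type*} [CommRing R] [IsLocalRing R] (I : Ideal R)
    [Nontrivial (R ⧸ I)] : IsLocalRing (R ⧸ I) :=
  .of_surjective' (Ideal.Quotient.mk _) Ideal.Quotient.mk_surjective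

theorem algebraMap_residueField_quotient_surjective {k R : Type*} [Field k] [CommRing R]
    [IsLocalRing R] [Algebra k R] (hk : Function.Surjective (algebraMap k (ResidueField R)))
    (I : Ideal R) [Nontrivial (R ⧸ I)] :
    Function.Surjective (algebraMap k (ResidueField (R ⧸ I))) := fun x => by
  have : IsLocalHom (Ideal.Quotient.mk I) := .of_surjective _ Ideal.Quotient.mk_surjective
  obtain ⟨x, rfl⟩ := residue_surjective x
  obtain ⟨x, rfl⟩ := Ideal.Quotient.mk_surjective x
  obtain ⟨c, hc⟩ := hk (residue R x)
  exact ⟨c, congr_arg (ResidueField.map (Ideal.Quotient.mk I)) hc⟩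

variable {k R : Type*} [Field k] [CommRing R] [IsLocalRing R]
  [IsNoetherianRing R] [Algebra k R] {n r : ℕ}
  (b : Module.Basis (Fin n) R Ω[R⁄k])

/-- The Jacobian criterion. -/
theorem isRegularLocalRing_iff_surjective_jacobian
    (hk : Function.Surjective (algebraMap k (ResidueField R)))
    (hdim : ringKrullDim R = n) {f : Fin r → R}
    (hf : RingTheory.Sequence.IsRegular R (List.ofFn f)) :
    IsRegularLocalRing (R ⧸ Ideal.span (Set.range f)) ↔
      Function.Surjective (jacobian b f).mulVecLin := by
  have : Nontrivial (R ⧸ Ideal.span (Set.range f)) := Ideal.Quotient.nontrivial_iff.mpr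
    hf.span_ne_top
  have hkA := algebraMap_residueField_quotient_surjective hk (Ideal.span (Set.range f))
  have hd := ringKrullDim_add_length_eq_ringKrullDim_of_isRegular _ hf
  rw [List.length_ofFn, hdim, Ideal.ofList_ofFn_eq_span] at hd
  have h1 := finrank_tensor_add_rank (K := ResidueField (R ⧸ Ideal.span (Set.range f)))
    (jacobian b f).transpose
    (toKaehler b f) (toKaehler_surjective b f) (exact_jacobian_toKaehler b f)
  rw [← finrank_cotangentSpace_eq_finrank_kaehler hkA, Matrix.transpose_map,
    Matrix.rank_transpose] at h1
  have h2 := finrank_tensor_add_rank (K := ResidueField (R ⧸ Ideal.span (Set.range f)))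
    (jacobian b f)
    (LinearMap.range (jacobian b f).mulVecLin).mkQ (Submodule.mkQ_surjective _)
    (LinearMap.exact_map_mkQ_range _)
  have h3 : Function.Surjective (jacobian b f).mulVecLin ↔
      Module.finrank (ResidueField (R ⧸ Ideal.span (Set.range f)))
        (ResidueField (R ⧸ Ideal.span (Set.range f)) ⊗[R ⧸ Ideal.span (Set.range f)]
          ((Fin r → R ⧸ Ideal.span (Set.range f)) ⧸
            LinearMap.range (jacobian b f).mulVecLin)) = 0 := by
    rw [Module.finrank_zero_iff, IsLocalRing.subsingleton_tensorProduct,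
      Submodule.Quotient.subsingleton_iff, LinearMap.range_eq_top]
  rw [IsRegularLocalRing.iff_finrank_cotangentSpace, h3]
  -- The equation `dim + r = n` excludes the values `⊥` and `⊤`, so the rest is arithmetic in `ℕ`.
  obtain ⟨d, hd'⟩ : ∃ d : ℕ, ringKrullDim (R ⧸ Ideal.span (Set.range f)) = d := by
    generalize ringKrullDim (R ⧸ Ideal.span (Set.range f)) = x at hd
    induction x with
    | bot => simp at hd
    | coe x =>
      induction x with
      | top => exact absurd (WithBot.coe_injective hd) (by simp)
      | coe d => exact ⟨d, rfl⟩
  rw [hd'] at hd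
  rw [hd', Nat.cast_inj]
  have : d + r = n := by exact_mod_cast hd
  omega

end Conormal

end

/-! ### Local rings of affine space: differentials, residue field, dimension. -/

section

open TensorProduct KaehlerDifferential IsLocalRing

namespace CIDeformation

variable {n r : ℕ}

instance (p : Fin n → ℂ) : Algebra.FormallyEtale (MvPolynomial (Fin n) ℂ) (AffineLocalRing p) :=
  Algebra.FormallyEtale.of_isLocalization (pointIdeal p).primeCompl

instance (p : Fin n → ℂ) : Algebra.EssFiniteType ℂ (AffineLocalRing p) :=
  Algebra.EssFiniteType.comp ℂ (MvPolynomial (Fin n) ℂ) _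

/-- The differentials `dx_j` form a basis of the differentials of `𝒪_{ℂⁿ,p}`. -/
def kaehlerBasis (p : Fin n → ℂ) :
    Module.Basis (Fin n) (AffineLocalRing p) Ω[AffineLocalRing p⁄ℂ] :=
  ((mvPolynomialBasis ℂ (Fin n)).baseChange (AffineLocalRing p)).map
    (tensorKaehlerEquivOfFormallyEtale ℂ (MvPolynomial (Fin n) ℂ) (AffineLocalRing p))

theorem kaehlerBasis_repr_D (p : Fin n → ℂ) (g : MvPolynomial (Fin n) ℂ) (j : Fin n) :
    (kaehlerBasis p).repr (D ℂ _ (germ p g)) j = germ p (MvPolynomial.pderiv j g) := by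
  have : (tensorKaehlerEquivOfFormallyEtale ℂ (MvPolynomial (Fin n) ℂ) (AffineLocalRing p)).symm
      (D ℂ _ (germ p g)) = 1 ⊗ₜ D ℂ _ g := by
    rw [LinearEquiv.symm_apply_eq]
    rw [tensorKaehlerEquivOfFormallyEtale_apply, mapBaseChange_tmul, map_D]
    exact (one_smul (AffineLocalRing p) (D ℂ (AffineLocalRing p) (germ p g))).symm
  rw [kaehlerBasis, Module.Basis.map_repr, LinearEquiv.trans_apply, this,
    Module.Basis.baseChange_repr_tmul, mvPolynomialBasis_repr_apply]
  simp [Algebra.smul_def]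

theorem jacobianAt_eq (f : Fin r → MvPolynomial (Fin n) ℂ) (p : Fin n → ℂ) :
    jacobianAt f p = Conormal.jacobian (kaehlerBasis p) fun i => germ p (f i) := by
  ext i j
  simp only [jacobianAt, Conormal.jacobian, Matrix.of_apply, kaehlerBasis_repr_D]

theorem residueField_surjective (p : Fin n → ℂ) :
    Function.Surjective (algebraMap ℂ (ResidueField (AffineLocalRing p))) := by
  have : (pointIdeal p).IsMaximal :=
    RingHom.ker_isMaximal_of_surjective _ fun c => ⟨MvPolynomial.C c, by simp⟩
  intro x
  obtain ⟨g, rfl⟩ := (pointIdeal p).algebraMap_residueField_surjective x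
  refine ⟨MvPolynomial.eval p g, ?_⟩
  rw [← sub_eq_zero, IsScalarTower.algebraMap_apply ℂ (MvPolynomial (Fin n) ℂ) (ResidueField _),
    ← map_sub]
  apply (Ideal.algebraMap_residueField_eq_zero (I := pointIdeal p)).mpr
  simp [RingHom.mem_ker]

/-- The automorphism `x ↦ x + a` of the polynomial ring. -/
def translation (a : Fin n → ℂ) : MvPolynomial (Fin n) ℂ ≃ₐ[ℂ] MvPolynomial (Fin n) ℂ :=
  AlgEquiv.ofAlgHom (MvPolynomial.aeval fun i => MvPolynomial.X i + MvPolynomial.C (a i))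
    (MvPolynomial.aeval fun i => MvPolynomial.X i - MvPolynomial.C (a i))
    (by ext1 i; simp [MvPolynomial.algHom_C, MvPolynomial.algebraMap_eq])
    (by ext1 i; simp [MvPolynomial.algHom_C, MvPolynomial.algebraMap_eq])

theorem comap_translation_pointIdeal (a p : Fin n → ℂ) :
    (pointIdeal p).comap (translation a).toRingEquiv = pointIdeal (p + a) := by
  have : (MvPolynomial.eval p).comp (translation a : _ →+* MvPolynomial (Fin n) ℂ) =
      MvPolynomial.eval (p + a) := by
    ext i <;> simp [translation]
  rw [pointIdeal, pointIdeal, ← this]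
  rfl

/-- Some maximal ideal has height `n`; by the Nullstellensatz it belongs to a point, and a
translation moves that point to `p`. -/
theorem height_pointIdeal (p : Fin n → ℂ) : (pointIdeal p).height = n := by
  have hdim : ringKrullDim (MvPolynomial (Fin n) ℂ) = n := by
    rw [MvPolynomial.ringKrullDim_of_isNoetherianRing, ringKrullDim_eq_zero_of_field]
    simp
  have : FiniteRingKrullDim (MvPolynomial (Fin n) ℂ) := by
    rw [finiteRingKrullDim_iff_ne_bot_and_top, hdim]
    exact ⟨WithBot.natCast_ne_bot n, fun h => by simpa using WithBot.coe_injective h⟩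
  obtain ⟨M, hM, h⟩ := Ideal.exists_isMaximal_height (R := MvPolynomial (Fin n) ℂ)
  obtain ⟨x, rfl⟩ := MvPolynomial.isMaximal_iff_eq_vanishingIdeal_singleton.mp hM
  have hx : MvPolynomial.vanishingIdeal ℂ {x} = pointIdeal x := by
    ext g
    simp [RingHom.mem_ker, MvPolynomial.aeval_eq_eval]
  rw [hx, hdim] at h
  have hp := comap_translation_pointIdeal (x - p) p
  rw [add_sub_cancel] at hp
  rw [← RingEquiv.height_comap (translation (x - p)).toRingEquiv, hp]
  exact_mod_cast h

theorem ringKrullDim_affineLocalRing (p : Fin n → ℂ) : ringKrullDim (AffineLocalRing p) = n := by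
  rw [IsLocalization.AtPrime.ringKrullDim_eq_height (pointIdeal p), height_pointIdeal]
  rfl

theorem isRegularLocalRing_iff {f : Fin r → MvPolynomial (Fin n) ℂ}
    (hf : IsCompleteIntersection f) {q : Fin n → ℂ} (hq : q ∈ points f) :
    IsRegularLocalRing (LocalRingAt f q) ↔ Function.Surjective (jacobianAt f q).mulVecLin := by
  rw [jacobianAt_eq]
  exact Conormal.isRegularLocalRing_iff_surjective_jacobian (kaehlerBasis q)
    (residueField_surjective q) (ringKrullDim_affineLocalRing q) (hf q hq)

theorem finite_T1_iff {f : Fin r → MvPolynomial (Fin n) ℂ}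
    (hf : IsCompleteIntersection f) {p : Fin n → ℂ} (hp : p ∈ points f)
    (hred : IsReduced (LocalRingAt f p)) :
    Module.Finite ℂ (T1 f p) ↔ Module.Finite ℂ (JacobianCokernel f p) := by
  have := Conormal.jacobian_transpose_injective (k := ℂ) (kaehlerBasis p) (hf p hp).toIsWeaklyRegular
    hred
  unfold JacobianCokernel
  rw [jacobianAt_eq]
  exact Conormal.finite_extOne_iff (k := ℂ) _ _ (Conormal.toKaehler_surjective _ _)
    (Conormal.exact_jacobian_toKaehler _ _) this

end CIDeformation

end

/-! ### Finite-dimensional modules over a local algebra. -/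

section

open IsLocalRing

/-- A finitely generated module over a Noetherian local `k`-algebra with residue field `k` is
finite-dimensional if it is annihilated by a power of the maximal ideal. -/
theorem Module.finite_of_maximalIdeal_pow_le_annihilator {k A : Type*} [Field k] [CommRing A]
    [IsLocalRing A] [IsNoetherianRing A] [Algebra k A]
    (hk : Function.Surjective (algebraMap k (ResidueField A))) (N : ℕ) (C : Type*)
    [AddCommGroup C] [Module A C] [Module k C] [IsScalarTower k A C] [Module.Finite A C]
    (h : maximalIdeal A ^ N ≤ Module.annihilator A C) : Module.Finite k C := by
  induction N generalizing C with
  | zero =>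
    rw [pow_zero, Ideal.one_eq_top, top_le_iff, Module.annihilator_eq_top_iff] at h
    infer_instance
  | succ N ih =>
    -- `mC` is killed by `m^N`, and on `C/mC` the ring acts through its residue field `k`.
    let D : Submodule A C := maximalIdeal A • ⊤
    have h1 : Module.Finite k D := ih D fun x hx => by
      rw [Module.mem_annihilator]
      have hD : D ≤ LinearMap.ker (LinearMap.lsmul A C x) := Submodule.smul_le.mpr fun y hy c _ => by
        rw [LinearMap.mem_ker, LinearMap.lsmul_apply, smul_smul]
        exact Module.mem_annihilator.mp
          (h (pow_succ (maximalIdeal A) N ▸ Ideal.mul_mem_mul hx hy)) c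
      rintro ⟨d, hd⟩
      exact Subtype.ext (hD hd)
    have h2 : Module.Finite k (C ⧸ D) := by
      have hfin : Module.Finite A (C ⧸ D) := inferInstance
      obtain ⟨s, hs⟩ := hfin.fg_top
      refine ⟨⟨s, eq_top_iff.mpr fun x _ => ?_⟩⟩
      have hx : x ∈ Submodule.span A (s : Set (C ⧸ D)) := hs ▸ Submodule.mem_top
      induction hx using Submodule.span_induction with
      | mem x hx => exact Submodule.subset_span hx
      | zero => exact zero_mem _
      | add x y _ _ hx hy => exact add_mem (hx trivial) (hy trivial)
      | smul a x _ hx =>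
        obtain ⟨c, hc⟩ := hk (residue A a)
        have hm : a - algebraMap k A c ∈ maximalIdeal A := by
          rw [← residue_eq_zero_iff, map_sub, ← hc, sub_eq_zero]
          rfl
        have : a • x = c • x := by
          rw [← sub_eq_zero, ← algebraMap_smul A c x, ← sub_smul]
          obtain ⟨y, rfl⟩ := D.mkQ_surjective x
          rw [← map_smul, Submodule.mkQ_apply, Submodule.Quotient.mk_eq_zero]
          exact Submodule.smul_mem_smul hm trivial
        rw [this]
        exact Submodule.smul_mem _ _ (hx trivial)
    have h3 : Module.Finite k (D.restrictScalars k) := h1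
    have h4 : Module.Finite k (C ⧸ D.restrictScalars k) :=
      Module.Finite.equiv (Submodule.Quotient.restrictScalarsEquiv k D).symm
    exact Module.Finite.of_submodule_quotient (D.restrictScalars k)

/-- Elements of the maximal ideal act nilpotently on a finite-dimensional module. -/
theorem Module.exists_pow_mem_annihilator_of_mem_maximalIdeal {k A : Type*} [Field k] [CommRing A]
    [IsLocalRing A] [Algebra k A] (C : Type*)
    [AddCommGroup C] [Module A C] [Module k C] [IsScalarTower k A C] [Module.Finite k C]
    {x : A} (hx : x ∈ maximalIdeal A) : ∃ N, x ^ N ∈ Module.annihilator A C := by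
  have : IsArtinian A C := isArtinian_of_tower k inferInstance
  have : Module.Finite A C := Module.Finite.of_restrictScalars_finite k A C
  obtain ⟨N, hN⟩ := IsArtinian.monotone_stabilizes
    ⟨fun N => OrderDual.toDual (LinearMap.range (LinearMap.lsmul A C (x ^ N))), by
      intro a b hab
      rw [OrderDual.toDual_le_toDual]
      rintro _ ⟨c, rfl⟩
      refine ⟨x ^ (b - a) • c, ?_⟩
      simp only [LinearMap.lsmul_apply, smul_smul, ← pow_add]
      rw [Nat.add_sub_cancel' hab]⟩
  refine ⟨N, ?_⟩
  have hN1 : LinearMap.range (LinearMap.lsmul A C (x ^ N)) =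
    LinearMap.range (LinearMap.lsmul A C (x ^ (N + 1))) := hN (N + 1) N.le_succ
  -- Stability gives `x^N C = x^(N+1) C ⊆ m x^N C`, so Nakayama applies.
  have hbot : LinearMap.range (LinearMap.lsmul A C (x ^ N)) = ⊥ := by
    refine Submodule.eq_bot_of_le_smul_of_le_jacobson_bot (maximalIdeal A) _
      (Module.Finite.iff_fg.mp inferInstance) ?_ (IsLocalRing.maximalIdeal_le_jacobson _)
    conv_lhs => rw [hN1]
    rintro _ ⟨c, rfl⟩
    rw [LinearMap.lsmul_apply, pow_succ', mul_smul]
    exact Submodule.smul_mem_smul hx ⟨c, rfl⟩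
  rw [Module.mem_annihilator]
  intro c
  exact LinearMap.congr_fun (LinearMap.range_eq_bot.mp hbot) c

theorem Module.finite_iff_forall_exists_pow_mem_annihilator {k A : Type*} [Field k] [CommRing A]
    [IsLocalRing A] [IsNoetherianRing A] [Algebra k A]
    (hk : Function.Surjective (algebraMap k (ResidueField A))) (C : Type*)
    [AddCommGroup C] [Module A C] [Module k C] [IsScalarTower k A C] [Module.Finite A C] :
    Module.Finite k C ↔ ∀ x ∈ maximalIdeal A, ∃ N : ℕ, x ^ N ∈ Module.annihilator A C := by
  refine ⟨fun _ x hx => exists_pow_mem_annihilator_of_mem_maximalIdeal (k := k) C hx, fun h => ?_⟩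
  obtain ⟨N, hN⟩ := Ideal.exists_pow_le_of_le_radical_of_fg (J := Module.annihilator A C) h
    (IsNoetherian.noetherian (maximalIdeal A))
  exact finite_of_maximalIdeal_pow_le_annihilator hk N C hN

end

section

open IsLocalRing

/-! ### Cokernels of matrices over a localization of a quotient -/

namespace Matrix

variable {S : Type*} [CommRing S] {n r : ℕ} (J : Matrix (Fin r) (Fin n) S) (I : Ideal S)

/-- The submodule `J(Sⁿ) + I S^r` of `S^r`. -/
def rangeSup : Submodule S (Fin r → S) :=
  LinearMap.range J.mulVecLin ⊔ Submodule.pi Set.univ fun _ => I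

theorem mem_rangeSup {v : Fin r → S} :
    v ∈ J.rangeSup I ↔ ∃ b : Fin n → S, ∀ i, v i - J.mulVec b i ∈ I := by
  rw [rangeSup, Submodule.mem_sup]
  constructor
  · rintro ⟨_, ⟨b, rfl⟩, z, hz, rfl⟩
    refine ⟨b, fun i => ?_⟩
    simpa using hz i trivial
  · rintro ⟨b, hb⟩
    exact ⟨_, ⟨b, rfl⟩, _, fun i _ => hb i, add_sub_cancel _ _⟩

/-- The annihilator of the cokernel of the matrix `J` over `S / I`. -/
def annihilatorCoker : Ideal S :=
  Module.annihilator S ((Fin r → S) ⧸ J.rangeSup I)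

theorem mem_annihilator_quotient_iff {m : ℕ} {N : Submodule S (Fin m → S)} {h : S} :
    h ∈ Module.annihilator S ((Fin m → S) ⧸ N) ↔ ∀ v, h • v ∈ N := by
  rw [Module.mem_annihilator, (Submodule.mkQ_surjective _).forall]
  exact forall_congr' fun v => by
    rw [← map_smul, Submodule.mkQ_apply, Submodule.Quotient.mk_eq_zero]

theorem mem_annihilatorCoker {h : S} :
    h ∈ J.annihilatorCoker I ↔ ∀ v, h • v ∈ J.rangeSup I :=
  mem_annihilator_quotient_iff

theorem le_annihilatorCoker : I ≤ J.annihilatorCoker I := fun h hh => by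
  rw [mem_annihilatorCoker]
  exact fun v => Submodule.mem_sup_right fun j _ => Ideal.mul_mem_right _ _ hh

variable {J I}
variable {A : Type*} [CommRing A] {φ : S →+* A} {M : Submonoid S}

theorem exists_common_denominator (hsurj : ∀ a, ∃ g ∈ M, ∃ s, φ g * a = φ s) {m : ℕ}
    (a : Fin m → A) : ∃ g ∈ M, ∃ s : Fin m → S, ∀ j, φ g * a j = φ (s j) := by
  choose g hg s hs using fun j => hsurj (a j)
  refine ⟨∏ j, g j, M.prod_mem fun j _ => hg j,
    fun j => (∏ l ∈ Finset.univ.erase j, g l) * s j, fun j => ?_⟩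
  rw [← Finset.prod_erase_mul _ _ (Finset.mem_univ j), map_mul, mul_assoc, hs, map_mul]

theorem exists_forall_smul_mem {m : ℕ} {P : Type*} [AddCommGroup P] [Module S P]
    {N : Fin m → Submodule S P} {v : Fin m → P} (h : ∀ j, ∃ g ∈ M, g • v j ∈ N j) :
    ∃ g ∈ M, ∀ j, g • v j ∈ N j := by
  choose g hg h using h
  refine ⟨∏ j, g j, M.prod_mem fun j _ => hg j, fun j => ?_⟩
  rw [← Finset.prod_erase_mul _ _ (Finset.mem_univ j), mul_smul]
  exact Submodule.smul_mem _ _ (h j)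

theorem map_mulVec_apply (b : Fin n → S) (i : Fin r) :
    (J.map φ).mulVec (fun j => φ (b j)) i = φ (J.mulVec b i) :=
  (RingHom.map_mulVec φ J b i).symm

/-- The three hypotheses on `φ` encode that `A` is the localization of `S/I` at `M`; the proof
clears denominators. -/
theorem map_mem_range_iff (hunit : ∀ g ∈ M, IsUnit (φ g))
    (hsurj : ∀ a, ∃ g ∈ M, ∃ s, φ g * a = φ s)
    (hker : ∀ s, φ s = 0 ↔ ∃ g ∈ M, g * s ∈ I) (v : Fin r → S) :
    (fun i => φ (v i)) ∈ LinearMap.range (J.map φ).mulVecLin ↔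
      ∃ g ∈ M, g • v ∈ J.rangeSup I := by
  constructor
  · rintro ⟨a, ha⟩
    obtain ⟨g, hg, s, hs⟩ := exists_common_denominator hsurj a
    have h0 : ∀ i, φ (g * v i - J.mulVec s i) = 0 := fun i => by
      have h1 : (fun j => φ g * a j) = φ g • a := rfl
      rw [map_sub, ← map_mulVec_apply, map_mul, ← funext hs, sub_eq_zero, h1, Matrix.mulVec_smul]
      exact congr_arg _ (congr_fun ha i).symm
    obtain ⟨g', hg', h⟩ := exists_forall_smul_mem (N := fun _ => I)
      fun i => (hker _).mp (h0 i)
    refine ⟨g' * g, M.mul_mem hg' hg, (mem_rangeSup J I).mpr ⟨g' • s, fun i => ?_⟩⟩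
    rw [Matrix.mulVec_smul]
    convert h i using 1
    simp only [Pi.smul_apply, smul_eq_mul]
    ring
  · rintro ⟨g, hg, h⟩
    obtain ⟨b, hb⟩ := (mem_rangeSup J I).mp h
    rw [← Submodule.smul_mem_iff_of_isUnit _ (hunit g hg)]
    refine ⟨fun j => φ (b j), ?_⟩
    ext i
    have := (hker _).mpr ⟨1, M.one_mem, by rw [one_mul]; exact hb i⟩
    rw [map_sub, sub_eq_zero] at this
    rw [Matrix.mulVecLin_apply, map_mulVec_apply, ← this]
    exact map_mul φ g (v i)

/-- If `A` is the localization of `S / I` at `M`, then the annihilator of the cokernel of `J` over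
`A` is the localization of the annihilator of its cokernel over `S / I`. -/
theorem map_mem_annihilator_iff (hunit : ∀ g ∈ M, IsUnit (φ g))
    (hsurj : ∀ a, ∃ g ∈ M, ∃ s, φ g * a = φ s)
    (hker : ∀ s, φ s = 0 ↔ ∃ g ∈ M, g * s ∈ I) (s : S) :
    φ s ∈ Module.annihilator A ((Fin r → A) ⧸ LinearMap.range (J.map φ).mulVecLin) ↔
      ∃ g ∈ M, g * s ∈ J.annihilatorCoker I := by
  rw [mem_annihilator_quotient_iff]
  constructor
  · intro h
    have : ∀ i : Fin r, ∃ g ∈ M, g • s • (Pi.single i 1 : Fin r → S) ∈ J.rangeSup I :=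
      fun i => (map_mem_range_iff hunit hsurj hker _).mp (by
        convert h (Pi.single i 1) using 1
        ext j
        by_cases hj : j = i
        · subst hj
          simp
        · simp [hj])
    obtain ⟨g, hg, h⟩ := exists_forall_smul_mem this
    refine ⟨g, hg, (mem_annihilatorCoker J I).mpr fun v => ?_⟩
    rw [pi_eq_sum_univ' v, Finset.smul_sum]
    refine sum_mem fun i _ => ?_
    rw [smul_comm, mul_smul]
    exact Submodule.smul_mem _ _ (h i)
  · rintro ⟨g, hg, h⟩ a
    obtain ⟨g', hg', t, ht⟩ := exists_common_denominator hsurj a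
    rw [← Submodule.smul_mem_iff_of_isUnit _ (hunit g' hg')]
    have := (map_mem_range_iff hunit hsurj hker (s • t)).mpr
      ⟨g, hg, by rw [smul_smul]; exact (mem_annihilatorCoker J I).mp h t⟩
    convert this using 1
    ext i
    simp only [Pi.smul_apply, smul_eq_mul, map_mul, ← ht]
    ring

end Matrix

/-! ### From the local ring of `X` back to polynomials. -/

namespace CIDeformation

section LocalizedQuotient

variable {S R : Type*} [CommRing S] [CommRing R] [Algebra S R] (M : Submonoid S)
  [IsLocalization M R] {r : ℕ} (f : Fin r → S)

variable (R) in
/-- The map from `S` to the quotient of a localization by `(f)`. -/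
def toLocalizedQuotient : S →+* R ⧸ Ideal.span (Set.range fun i => algebraMap S R (f i)) :=
  (Ideal.Quotient.mk _).comp (algebraMap S R)

theorem isUnit_toLocalizedQuotient (g : S) (hg : g ∈ M) : IsUnit (toLocalizedQuotient R f g) :=
  (IsLocalization.map_units R (⟨g, hg⟩ : M)).map (Ideal.Quotient.mk _)

theorem exists_mul_eq_toLocalizedQuotient
    (a : R ⧸ Ideal.span (Set.range fun i => algebraMap S R (f i))) :
    ∃ g ∈ M, ∃ s, toLocalizedQuotient R f g * a = toLocalizedQuotient R f s := by
  obtain ⟨x, rfl⟩ := Ideal.Quotient.mk_surjective a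
  obtain ⟨⟨s, g⟩, hs⟩ := IsLocalization.surj M x
  exact ⟨g, g.2, s, (mul_comm _ _).trans (congr_arg (Ideal.Quotient.mk _) hs)⟩

theorem toLocalizedQuotient_eq_zero_iff (s : S) :
    toLocalizedQuotient R f s = 0 ↔ ∃ g ∈ M, g * s ∈ Ideal.span (Set.range f) := by
  have : Ideal.span (Set.range fun i => algebraMap S R (f i)) =
      (Ideal.span (Set.range f)).map (algebraMap S R) := by
    rw [Ideal.map_span, ← Set.range_comp]
    rfl
  rw [toLocalizedQuotient, RingHom.comp_apply, Ideal.Quotient.eq_zero_iff_mem, this,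
    IsLocalization.algebraMap_mem_map_algebraMap_iff M]

theorem toLocalizedQuotient_mem_annihilator_iff {n : ℕ} (J : Matrix (Fin r) (Fin n) S) (s : S) :
    toLocalizedQuotient R f s ∈ Module.annihilator _
        ((Fin r → R ⧸ Ideal.span (Set.range fun i => algebraMap S R (f i))) ⧸
          LinearMap.range (Matrix.of fun i j => toLocalizedQuotient R f (J i j)).mulVecLin) ↔
      ∃ g ∈ M, g * s ∈ J.annihilatorCoker (Ideal.span (Set.range f)) :=
  Matrix.map_mem_annihilator_iff (isUnit_toLocalizedQuotient M f)
    (exists_mul_eq_toLocalizedQuotient M f) (toLocalizedQuotient_eq_zero_iff M f) s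

/-- Up to units, the elements of the maximal ideal are the images of elements of `P`. -/
theorem forall_mem_maximalIdeal_exists_pow_mem_iff {P : Ideal S} [P.IsPrime]
    [IsLocalization.AtPrime R P] [IsLocalRing R]
    [Nontrivial (R ⧸ Ideal.span (Set.range fun i => algebraMap S R (f i)))]
    (K : Ideal (R ⧸ Ideal.span (Set.range fun i => algebraMap S R (f i)))) :
    (∀ x ∈ maximalIdeal (R ⧸ Ideal.span (Set.range fun i => algebraMap S R (f i))),
        ∃ N : ℕ, x ^ N ∈ K) ↔
      ∀ h ∈ P, ∃ N : ℕ, toLocalizedQuotient R f h ^ N ∈ K := by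
  constructor
  · intro H h hh
    refine H _ ((mem_maximalIdeal _).mpr fun hu => ?_)
    have : IsLocalHom
        (Ideal.Quotient.mk (Ideal.span (Set.range fun i => algebraMap S R (f i)))) :=
      .of_surjective _ Ideal.Quotient.mk_surjective
    exact (mem_maximalIdeal _).mp ((IsLocalization.AtPrime.to_map_mem_maximal_iff R P h).mpr hh)
      (isUnit_of_map_unit (Ideal.Quotient.mk _) _ hu)
  · intro H x hx
    obtain ⟨g, hg, h, e⟩ := exists_mul_eq_toLocalizedQuotient P.primeCompl f x
    have hh : h ∈ P := by
      by_contra hne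
      refine (mem_maximalIdeal _).mp hx
        (isUnit_of_mul_isUnit_right (x := toLocalizedQuotient R f g) ?_)
      rw [e]
      exact isUnit_toLocalizedQuotient P.primeCompl f h hne
    obtain ⟨N, hN⟩ := H h hh
    refine ⟨N, ?_⟩
    rw [← e, mul_pow] at hN
    exact (Ideal.unit_mul_mem_iff_mem _
      ((isUnit_toLocalizedQuotient P.primeCompl f g hg).pow N)).mp hN

end LocalizedQuotient

variable {n r : ℕ} (f : Fin r → MvPolynomial (Fin n) ℂ) (q : Fin n → ℂ)

/-- The Jacobian matrix of polynomials. -/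
def polyJacobian : Matrix (Fin r) (Fin n) (MvPolynomial (Fin n) ℂ) :=
  Matrix.of fun i j => MvPolynomial.pderiv j (f i)

/-- The annihilator of the cokernel of the Jacobian map over `ℂ[x₁, …, xₙ] / (f)`. -/
def jacobianIdeal : Ideal (MvPolynomial (Fin n) ℂ) :=
  (polyJacobian f).annihilatorCoker (Ideal.span (Set.range f))

/-- A polynomial annihilates the Jacobian cokernel at `q` if and only if it lies in
the localization of the Jacobian ideal at `q`. -/
theorem mem_annihilator_jacobianCokernel_iff (s : MvPolynomial (Fin n) ℂ) :
    toLocalizedQuotient (AffineLocalRing q) f s ∈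
        Module.annihilator (LocalRingAt f q) (JacobianCokernel f q) ↔
      ∃ g ∈ (pointIdeal q).primeCompl, g * s ∈ jacobianIdeal f := by
  exact toLocalizedQuotient_mem_annihilator_iff (pointIdeal q).primeCompl f (polyJacobian f) s

end CIDeformation

end

/-! ### The singular locus as a zero set, and the Nullstellensatz. -/

section

open IsLocalRing

namespace CIDeformation

variable {n r : ℕ} {f : Fin r → MvPolynomial (Fin n) ℂ}

/-- On `X`, regularity means that `1` kills the local cokernel, so that some element of the Jacobian
ideal is nonzero at `q`. Off `X` both sides fail, since the ideal contains the `fᵢ`. -/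
theorem mem_singularLocus_iff (hf : IsCompleteIntersection f) (q : Fin n → ℂ) :
    q ∈ singularLocus f ↔ ∀ h ∈ jacobianIdeal f, MvPolynomial.eval q h = 0 := by
  by_cases hq : q ∈ points f
  · have h1 := mem_annihilator_jacobianCokernel_iff f q 1
    rw [map_one, ← Ideal.eq_top_iff_one, Module.annihilator_eq_top_iff,
      Submodule.Quotient.subsingleton_iff, LinearMap.range_eq_top] at h1
    simp only [singularLocus, Set.mem_ofPred_eq, hq, true_and, isRegularLocalRing_iff hf hq, h1,
      mul_one, not_exists, not_and]
    refine forall_congr' fun g => ⟨fun h hg => ?_, fun h hg hg' => hg (h hg')⟩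
    by_contra hne
    exact h hne hg
  · refine ⟨fun h => absurd h.1 hq, fun h => absurd (fun i => h _ ?_) hq⟩
    exact Matrix.le_annihilatorCoker _ _ (Ideal.subset_span ⟨i, rfl⟩)

theorem finite_jacobianCokernel_iff (hf : IsCompleteIntersection f) {p : Fin n → ℂ}
    (hp : p ∈ points f) :
    Module.Finite ℂ (JacobianCokernel f p) ↔ ∀ h ∈ pointIdeal p, ∃ N : ℕ,
      ∃ g ∈ (pointIdeal p).primeCompl, g * h ^ N ∈ jacobianIdeal f := by
  simp only [← mem_annihilator_jacobianCokernel_iff, map_pow]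
  have : Nontrivial (LocalRingAt f p) := Ideal.Quotient.nontrivial_iff.mpr (hf p hp).span_ne_top
  rw [← forall_mem_maximalIdeal_exists_pow_mem_iff]
  exact Module.finite_iff_forall_exists_pow_mem_annihilator
    (Conormal.algebraMap_residueField_quotient_surjective (residueField_surjective p) _) _

theorem not_mem_or_isIsolated_iff (hf : IsCompleteIntersection f) (p : Fin n → ℂ) :
    p ∉ singularLocus f ∨ IsIsolatedSingularPoint f p ↔ ∀ h ∈ pointIdeal p, ∃ N : ℕ,
      ∃ g ∈ (pointIdeal p).primeCompl, g * h ^ N ∈ jacobianIdeal f := by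
  constructor
  · intro hp h hh
    obtain ⟨g, hg, hgp⟩ : ∃ g : MvPolynomial (Fin n) ℂ, MvPolynomial.eval p g ≠ 0 ∧
        ∀ q ∈ singularLocus f, MvPolynomial.eval q g ≠ 0 → q = p := by
      rcases hp with hp | hp
      · rw [mem_singularLocus_iff hf] at hp
        push Not at hp
        obtain ⟨g, hg, hg0⟩ := hp
        exact ⟨g, hg0, fun q hq hq' => absurd ((mem_singularLocus_iff hf q).mp hq g hg) hq'⟩
      · exact hp.2
    -- On the singular locus `g` vanishes except possibly at `p`, where `h` vanishes.
    have hrad : g * h ∈ (jacobianIdeal f).radical := by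
      rw [← MvPolynomial.vanishingIdeal_zeroLocus_eq_radical (K := ℂ),
        MvPolynomial.mem_vanishingIdeal_iff]
      intro q hq
      rw [MvPolynomial.aeval_eq_eval, map_mul]
      by_cases hgq : MvPolynomial.eval q g = 0
      · rw [hgq, zero_mul]
      · have hqp := hgp q ((mem_singularLocus_iff hf q).mpr fun a ha => by
          simpa [MvPolynomial.aeval_eq_eval] using hq a ha) hgq
        rw [hqp, RingHom.mem_ker.mp hh, mul_zero]
    obtain ⟨N, hN⟩ := hrad
    rw [mul_pow] at hN
    exact ⟨N, g ^ N, (pointIdeal p).primeCompl.pow_mem hg N, hN⟩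
  · intro H
    -- The functions `xⱼ - pⱼ` suffice: where the product of their denominators is nonzero, a
    -- singular point has the coordinates of `p`.
    have hX : ∀ j : Fin n, MvPolynomial.X j - MvPolynomial.C (p j) ∈ pointIdeal p := fun j => by
      simp [RingHom.mem_ker]
    choose N g hg hgN using fun j => H _ (hX j)
    by_cases hp : p ∈ singularLocus f
    · refine Or.inr ⟨hp, ∏ j, g j, (pointIdeal p).primeCompl.prod_mem fun j _ => hg j, ?_⟩
      intro q hq hq'
      ext j
      have h1 := (mem_singularLocus_iff hf q).mp hq _ (hgN j)
      have h2 : MvPolynomial.eval q (g j) ≠ 0 := fun h0 => hq' (by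
        rw [map_prod]
        exact Finset.prod_eq_zero (Finset.mem_univ j) h0)
      simp only [map_mul, map_pow, map_sub, MvPolynomial.eval_X, MvPolynomial.eval_C] at h1
      exact sub_eq_zero.mp (eq_zero_of_pow_eq_zero ((mul_eq_zero.mp h1).resolve_left h2))
    · exact Or.inl hp

end CIDeformation

end

end

theorem theorem3p3 {n r : ℕ} (f : Fin r → MvPolynomial (Fin n) ℂ)
    (hf : CIDeformation.IsCompleteIntersection f)
    (p : Fin n → ℂ) (hp : p ∈ CIDeformation.points f) :
    (IsReduced (CIDeformation.LocalRingAt f p) →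
      (Module.Finite ℂ (CIDeformation.T1 f p) ↔
        (p ∉ CIDeformation.singularLocus f ∨ CIDeformation.IsIsolatedSingularPoint f p))) ∧
    (Module.Finite ℂ (CIDeformation.JacobianCokernel f p) ↔
      (p ∉ CIDeformation.singularLocus f ∨ CIDeformation.IsIsolatedSingularPoint f p)) := by
  have h : Module.Finite ℂ (CIDeformation.JacobianCokernel f p) ↔
      (p ∉ CIDeformation.singularLocus f ∨ CIDeformation.IsIsolatedSingularPoint f p) :=
    (CIDeformation.finite_jacobianCokernel_iff hf hp).trans
      (CIDeformation.not_mem_or_isIsolated_iff hf p).symm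
  exact ⟨fun hred => (CIDeformation.finite_T1_iff hf hp hred).trans h, h⟩
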